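/- Let $\mathbb K=\mathbb R$ or $\mathbb C$. A subset $A$ of a Banach space $X$ over $\mathbb K$ is called coarse $1$-limited if $T(A)$ is relatively compact in $\ell_1$ for every bounded linear operator $T:X\to\ell_1$, and $X$ has the coarse $1$-Gelfand–Phillips property if every coarse $1$-limited subset of $X$ is relatively compact. $X$ is a Schur space if every weakly convergent sequence in $X$ is norm convergent. Let $\mu$ be an arbitrary (positive) measure on a measurable space, and let $L_1(\mu)$ be the Banach space of (classes of) $\mathbb K$-valued $\mu$-integrable functions. Then $L_1(\mu)$ has the coarse $1$-Gelfand–Phillips property if and only if $L_1(\mu)$ is a Schur space. -/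

import Mathlib

open Filter Topology MeasureTheory
open scoped ENNReal

/-- A subset `A` of a Banach space `X` is coarse `p`-limited (`1 ≤ p < ∞`) if `T(A)` is relatively
compact in `ℓ_p` for every bounded linear operator `T : X → ℓ_p`. -/
def IsCoarseLimited (𝕜 : Type*) [RCLike 𝕜] (p : ℝ≥0∞) [Fact (1 ≤ p)]
    {X : Type*} [NormedAddCommGroup X] [NormedSpace 𝕜 X] (A : Set X) : Prop :=
  ∀ T : X →L[𝕜] lp (fun _ : ℕ => 𝕜) p, IsCompact (closure (T '' A))

/-- `X` has the coarse `p`-Gelfand–Phillips property (`1 ≤ p < ∞`) if every coarse `p`-limited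
subset of `X` is relatively compact. -/
def CoarseGelfandPhillips (𝕜 : Type*) [RCLike 𝕜] (p : ℝ≥0∞) [Fact (1 ≤ p)]
    (X : Type*) [NormedAddCommGroup X] [NormedSpace 𝕜 X] : Prop :=
  ∀ A : Set X, IsCoarseLimited 𝕜 p A → IsCompact (closure A)

/-- `X` is a Schur space if every weakly convergent sequence in `X` converges in norm
(to its weak limit). -/
def IsSchurSpace (𝕜 : Type*) [RCLike 𝕜]
    (X : Type*) [NormedAddCommGroup X] [NormedSpace 𝕜 X] : Prop :=
  ∀ (x : ℕ → X) (a : X),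
    Tendsto (fun n => toWeakSpace 𝕜 X (x n)) atTop (𝓝 (toWeakSpace 𝕜 X a)) →
      Tendsto x atTop (𝓝 a)

/-!
A Banach space `X` with the coarse `1`-Gelfand-Phillips property is always a Schur space
(`CoarseGelfandPhillips.isSchurSpace`). Operators `X → ℓ¹` turn weak convergence of sequences into
norm convergence, by Schur's theorem `isSchurSpace_lp_one`, so the range of a weakly convergent
sequence is coarse `1`-limited, hence relatively compact, and on a compact set the weak limit is the
only possible norm limit.

Conversely, let `L¹(μ)` be a Schur space and `f n` a coarse `1`-limited sequence in it. The sequence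
is bounded, so `φ = ∑ n, 2⁻ⁿ |f n|` is integrable. Two facts show that `{f n}` is totally bounded.

* The masses `∫ |f n|` over `{C * φ < |f n|}` tend to zero, uniformly in `n`, as `C → ∞`
  (`IsCoarseLimited.exists_forall_setIntegral_le`). Otherwise a gliding hump argument gives a
  subsequence `g k` and pairwise disjoint sets `S k` with `∫_{S k} |g k| ≥ δ > 0`. The operator
  `f ↦ (∫_{S k} sgn(g k) f)_k` to `ℓ¹`, with `sgn` the conjugate sign, then maps `g k` to vectors
  with `k`-th coordinate at least `δ`, which is impossible in a compact set.
* Order intervals `{f | |f| ≤ C * φ}` are totally bounded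
  (`totallyBounded_setOf_norm_le_mul_norm_sq`). They are contained in images of balls under the
  multiplication by `√φ`, which maps the Hilbert space `L²(μ)` to `L¹(μ)`. An operator from a Hilbert
  space into a Schur space is compact, because orthonormal sequences are weakly null.

No decomposition of `μ` into atoms and a diffuse part is needed.
-/

/-! ### Weak convergence and total boundedness -/

section Weak

variable {𝕜 : Type*} [RCLike 𝕜] {X : Type*} [NormedAddCommGroup X] [NormedSpace 𝕜 X]

theorem tendsto_toWeakSpace_iff {ι : Type*} {l : Filter ι} {x : ι → X} {a : X} :
    Tendsto (fun n => toWeakSpace 𝕜 X (x n)) l (𝓝 (toWeakSpace 𝕜 X a)) ↔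
      ∀ φ : X →L[𝕜] 𝕜, Tendsto (fun n => φ (x n)) l (𝓝 (φ a)) :=
  WeakBilin.tendsto_iff_forall_eval_tendsto _
    (by
      intro y z h
      refine (SeparatingDual.eq_iff_forall_dual_eq (R := 𝕜)).2 fun g => ?_
      exact DFunLike.congr_fun h g)

theorem totallyBounded_of_forall_approx {α : Type*} [PseudoMetricSpace α] {s : Set α}
    (h : ∀ ε > 0, ∃ t : Set α, TotallyBounded t ∧ ∀ x ∈ s, ∃ y ∈ t, dist x y ≤ ε) :
    TotallyBounded s := by
  refine Metric.totallyBounded_iff.2 fun ε hε => ?_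
  obtain ⟨t, ht, hst⟩ := h (ε / 2) (by positivity)
  obtain ⟨F, hF, htF⟩ := Metric.totallyBounded_iff.1 ht (ε / 2) (by positivity)
  refine ⟨F, hF, fun x hx => ?_⟩
  obtain ⟨y, hy, hxy⟩ := hst x hx
  obtain ⟨z, hz, hyz⟩ := Set.mem_iUnion₂.1 (htF hy)
  refine Set.mem_iUnion₂.2 ⟨z, hz, ?_⟩
  rw [Metric.mem_ball] at hyz ⊢
  linarith [dist_triangle x y z]

end Weak

/-! ### The Schur property of `ℓ¹` -/

section EllOne

variable {𝕜 : Type*} [RCLike 𝕜]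

theorem lp_one_summable_norm (x : lp (fun _ : ℕ => 𝕜) 1) : Summable fun i => ‖x i‖ := by
  simpa using (lp.hasSum_norm (by simp) x).summable

theorem lp_one_norm_eq_tsum (x : lp (fun _ : ℕ => 𝕜) 1) : ‖x‖ = ∑' i, ‖x i‖ := by
  simpa using lp.norm_rpow_eq_tsum (by simp) x

theorem lp_one_summable_mul {h : ℕ → 𝕜} (hh : ∀ i, ‖h i‖ ≤ 1) (x : lp (fun _ : ℕ => 𝕜) 1) :
    Summable fun i => h i * x i :=
  (lp_one_summable_norm x).of_norm_bounded fun i => by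
    rw [norm_mul]
    exact mul_le_of_le_one_left (norm_nonneg _) (hh i)

/-- The functional on `ℓ¹` given by pairing with a sequence in the unit ball of `ℓ^∞`. -/
noncomputable def lpOnePairing (h : ℕ → 𝕜) (hh : ∀ i, ‖h i‖ ≤ 1) :
    lp (fun _ : ℕ => 𝕜) 1 →L[𝕜] 𝕜 :=
  LinearMap.mkContinuous
    { toFun := fun x => ∑' i, h i * x i
      map_add' := fun x y => by
        rw [← (lp_one_summable_mul hh x).tsum_add (lp_one_summable_mul hh y)]
        simp [mul_add]
      map_smul' := fun c x => by
        simp [← tsum_mul_left, mul_left_comm] } 1 fun x => by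
    rw [one_mul, lp_one_norm_eq_tsum]
    refine tsum_of_norm_bounded (lp_one_summable_norm x).hasSum fun i => ?_
    rw [norm_mul]
    exact mul_le_of_le_one_left (norm_nonneg _) (hh i)

theorem norm_conj_div_norm_le (z : 𝕜) : ‖(starRingEnd 𝕜) z / (‖z‖ : 𝕜)‖ ≤ 1 := by
  rw [norm_div, RCLike.norm_conj, RCLike.norm_ofReal, abs_norm]
  exact div_self_le_one _

theorem conj_div_norm_mul_self (z : 𝕜) : (starRingEnd 𝕜) z / (‖z‖ : 𝕜) * z = (‖z‖ : 𝕜) := by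
  rcases eq_or_ne z 0 with rfl | hz
  · simp
  · have : (‖z‖ : 𝕜) ≠ 0 := by simpa using hz
    field_simp
    rw [mul_comm, RCLike.mul_conj]

/-- If `x n` is weakly null in `ℓ¹`, then the unit ball of `ℓ^∞`, compact in the product topology,
is the union of the closed sets where `|⟨h, x n⟩| ≤ ε` for all `n ≥ m`, so by Baire one of them
contains a cylinder. Testing against `h` that is free beyond the first `N` coordinates bounds the
tails of all `x n`, `n ≥ m`. -/
theorem exists_tail_bound_of_weakly_null {x : ℕ → lp (fun _ : ℕ => 𝕜) 1}
    (hx : ∀ φ : lp (fun _ : ℕ => 𝕜) 1 →L[𝕜] 𝕜, Tendsto (fun n => φ (x n)) atTop (𝓝 0))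
    {ε : ℝ} (hε : 0 < ε) :
    ∃ N m : ℕ, ∀ n ≥ m, ‖x n‖ ≤ ε + 2 * ∑ i ∈ Finset.range N, ‖x n i‖ := by
  classical
  let B := ℕ → Metric.closedBall (0 : 𝕜) 1
  have hB : ∀ (h : B) i, ‖(h i : 𝕜)‖ ≤ 1 := fun h i => mem_closedBall_zero_iff.1 (h i).2
  let p : B → ℕ → 𝕜 := fun h n => ∑' i, (h i : 𝕜) * x n i
  have hp : ∀ n, Continuous fun h => p h n := fun n =>
    continuous_tsum (fun i => by fun_prop) (lp_one_summable_norm (x n)) fun i h => by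
      rw [norm_mul]
      exact mul_le_of_le_one_left (norm_nonneg _) (hB h i)
  have hne : Nonempty B := ⟨fun _ => ⟨0, by simp⟩⟩
  obtain ⟨m, h₀, hh₀⟩ := nonempty_interior_of_iUnion_of_closed
    (f := fun m : ℕ => {h : B | ∀ n ≥ m, ‖p h n‖ ≤ ε})
    (fun m => by
      simp only [Set.ofPred_forall]
      exact isClosed_iInter fun n => isClosed_iInter fun _ =>
        isClosed_le (hp n).norm continuous_const)
    (by
      refine Set.eq_univ_of_forall fun h => ?_
      have h1 := (hx (lpOnePairing (fun i => (h i : 𝕜)) (hB h))).norm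
      rw [norm_zero] at h1
      obtain ⟨m, hm⟩ := eventually_atTop.1 (h1.eventually_le_const hε)
      exact Set.mem_iUnion.2 ⟨m, hm⟩)
  rw [mem_interior_iff_mem_nhds, nhds_pi, Filter.mem_pi'] at hh₀
  obtain ⟨I, t, ht, hsub⟩ := hh₀
  obtain ⟨N, hN⟩ := I.exists_nat_subset_range
  refine ⟨N, m, fun n hn => ?_⟩
  -- `h` agrees with the centre `h₀` of the cylinder below `N`, and has the conjugate signs of `x n`
  -- from `N` on.
  let h : B := fun i => if i < N then h₀ i else
    ⟨(starRingEnd 𝕜) (x n i) / (‖x n i‖ : 𝕜), by simpa using norm_conj_div_norm_le (x n i)⟩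
  have hmem : h ∈ {h : B | ∀ n ≥ m, ‖p h n‖ ≤ ε} := hsub fun i hi => by
    have : i < N := Finset.mem_range.1 (hN hi)
    simpa only [h, this, if_true] using mem_of_mem_nhds (ht i)
  have hpn := hmem n hn
  have hs : Summable fun i => (h i : 𝕜) * x n i := lp_one_summable_mul (hB h) (x n)
  have e1 : p h n = ∑ i ∈ Finset.range N, (h i : 𝕜) * x n i + ∑' i, ((‖x n (i + N)‖ : ℝ) : 𝕜) := by
    rw [show p h n = ∑' i, (h i : 𝕜) * x n i from rfl, ← hs.sum_add_tsum_nat_add N]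
    congr 2
    funext i
    simp only [h, not_lt.2 (Nat.le_add_left N i), if_false]
    exact conj_div_norm_mul_self _
  have e2 : ∑' i, ‖x n (i + N)‖ = ‖p h n - ∑ i ∈ Finset.range N, (h i : 𝕜) * x n i‖ := by
    rw [e1, add_sub_cancel_left, ← RCLike.ofReal_tsum, RCLike.norm_ofReal, abs_of_nonneg]
    exact tsum_nonneg fun i => norm_nonneg _
  have e3 : ‖∑ i ∈ Finset.range N, (h i : 𝕜) * x n i‖ ≤ ∑ i ∈ Finset.range N, ‖x n i‖ :=
    norm_sum_le_of_le _ fun i _ => by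
      rw [norm_mul]
      exact mul_le_of_le_one_left (norm_nonneg _) (hB h i)
  rw [lp_one_norm_eq_tsum, ← (lp_one_summable_norm (x n)).sum_add_tsum_nat_add N, e2]
  linarith [norm_sub_le (p h n) (∑ i ∈ Finset.range N, (h i : 𝕜) * x n i)]

theorem lp_one_tendsto_zero_of_weakly_null {x : ℕ → lp (fun _ : ℕ => 𝕜) 1}
    (hx : ∀ φ : lp (fun _ : ℕ => 𝕜) 1 →L[𝕜] 𝕜, Tendsto (fun n => φ (x n)) atTop (𝓝 0)) :
    Tendsto x atTop (𝓝 0) := by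
  rw [Metric.tendsto_atTop']
  intro ε hε
  obtain ⟨N, m, h⟩ := exists_tail_bound_of_weakly_null hx (half_pos hε)
  have hc : ∀ i, Tendsto (fun n => ‖x n i‖) atTop (𝓝 0) := fun i => by
    rw [← norm_zero (E := 𝕜)]
    exact (hx (lp.evalCLM 𝕜 (fun _ : ℕ => 𝕜) 1 i)).norm
  have hs : Tendsto (fun n => 2 * ∑ i ∈ Finset.range N, ‖x n i‖) atTop (𝓝 0) := by
    simpa using (tendsto_finsetSum (Finset.range N) fun i _ => hc i).const_mul 2
  obtain ⟨m', hm'⟩ := eventually_atTop.1 (hs.eventually_lt_const (half_pos hε))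
  refine ⟨max m m', fun n hn => ?_⟩
  rw [dist_zero_right]
  linarith [h n (by omega), hm' n (by omega)]

/-- Schur's theorem. -/
theorem isSchurSpace_lp_one : IsSchurSpace 𝕜 (lp (fun _ : ℕ => 𝕜) 1) := by
  intro x a h
  rw [tendsto_toWeakSpace_iff] at h
  rw [← tendsto_sub_nhds_zero_iff]
  refine lp_one_tendsto_zero_of_weakly_null fun φ => ?_
  simpa using (h φ).sub_const (φ a)

/-- Coordinates at infinity are uniformly small on a compact subset of `ℓ¹`, so that the diagonal of
a sequence in it tends to zero along a subsequence. -/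
theorem exists_norm_diagonal_lt {x : ℕ → lp (fun _ : ℕ => 𝕜) 1} {K : Set (lp (fun _ : ℕ => 𝕜) 1)}
    (hK : IsCompact K) (hx : ∀ n, x n ∈ K) {δ : ℝ} (hδ : 0 < δ) : ∃ n, ‖x n n‖ < δ := by
  obtain ⟨y, -, s, hs, hy⟩ := hK.tendsto_subseq hx
  have h1 := ((lp_one_summable_norm y).tendsto_atTop_zero.comp hs.tendsto_atTop).add
    (tendsto_iff_norm_sub_tendsto_zero.1 hy)
  rw [add_zero] at h1
  obtain ⟨n, hn⟩ := (h1.eventually_lt_const hδ).exists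
  refine ⟨s n, ?_⟩
  have h2 := lp.norm_apply_le_norm one_ne_zero (x (s n) - y) (s n)
  have h3 := norm_le_norm_add_norm_sub' (x (s n) (s n)) (y (s n))
  simp only [Function.comp_apply, lp.coeFn_sub, Pi.sub_apply] at hn h2
  linarith

end EllOne

/-! ### Coarse `1`-limited sets in general Banach spaces -/

section General

variable {𝕜 : Type*} [RCLike 𝕜] {X : Type*} [NormedAddCommGroup X] [NormedSpace 𝕜 X]

/-- By Schur's theorem, operators to `ℓ¹` map weakly convergent sequences to norm convergent ones, so
a weakly convergent sequence is coarse `1`-limited. -/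
theorem CoarseGelfandPhillips.isSchurSpace (h : CoarseGelfandPhillips 𝕜 1 X) :
    IsSchurSpace 𝕜 X := by
  intro x a hxa
  rw [tendsto_toWeakSpace_iff] at hxa
  have hK : IsCompact (closure (Set.range x)) := by
    refine h _ fun T => ?_
    have hT : Tendsto (fun n => T (x n)) atTop (𝓝 (T a)) :=
      isSchurSpace_lp_one (𝕜 := 𝕜) _ _ (tendsto_toWeakSpace_iff.2 fun φ => hxa (φ.comp T))
    refine hT.isCompact_insert_range.closure_of_subset ?_
    rw [← Set.range_comp]
    exact Set.subset_insert _ _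
  refine tendsto_of_subseq_tendsto fun ns hns => ?_
  obtain ⟨b, -, s, hs, hb⟩ := hK.tendsto_subseq fun n => subset_closure (Set.mem_range_self (ns n))
  have hab : b = a := (SeparatingDual.eq_iff_forall_dual_eq (R := 𝕜)).2 fun φ =>
    tendsto_nhds_unique ((φ.continuous.tendsto b).comp hb)
      ((hxa φ).comp (hns.comp hs.tendsto_atTop))
  exact ⟨s, hab ▸ hb⟩

theorem IsCoarseLimited.closure {A : Set X} (hA : IsCoarseLimited 𝕜 1 A) :
    IsCoarseLimited 𝕜 1 (closure A) := fun T =>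
  (hA T).of_isClosed_subset isClosed_closure
    (closure_minimal (image_closure_subset_closure_image T.continuous) isClosed_closure)

/-- Each functional is bounded on the set, since it is an operator to a copy of `𝕜` inside `ℓ¹`, and
the uniform boundedness principle applies. -/
theorem IsCoarseLimited.exists_norm_le {A : Set X} (hA : IsCoarseLimited 𝕜 1 A) :
    ∃ M > 0, ∀ x ∈ A, ‖x‖ ≤ M := by
  obtain ⟨M, hM⟩ := banach_steinhaus
    (g := fun x : A => NormedSpace.inclusionInDoubleDual 𝕜 X (x : X)) fun φ => by
    obtain ⟨C, hC⟩ := (hA ((lp.singleContinuousLinearMap 𝕜 (fun _ : ℕ => 𝕜) 1 0).comp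
      φ)).isBounded.exists_norm_le
    refine ⟨C, fun x => ?_⟩
    have := hC _ (subset_closure (Set.mem_image_of_mem _ x.2))
    simpa using this
  refine ⟨max M 1, by positivity, fun x hx => le_max_of_le_left ?_⟩
  have := hM ⟨x, hx⟩
  rwa [show ‖NormedSpace.inclusionInDoubleDual 𝕜 X x‖ = ‖x‖ from
    (NormedSpace.inclusionInDoubleDualLi 𝕜 (E := X)).norm_map x] at this

theorem isCompact_closure_of_forall_seq [CompleteSpace X] {A : Set X}
    (h : ∀ f : ℕ → X, (∀ n, f n ∈ closure A) → TotallyBounded (Set.range f)) :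
    IsCompact (closure A) := by
  refine IsSeqCompact.isCompact fun f hf => ?_
  have hK := isCompact_iff_totallyBounded_isComplete.2
    ⟨(h f hf).closure, isClosed_closure.isComplete⟩
  obtain ⟨a, ha, s, hs, hsa⟩ := hK.tendsto_subseq fun n => subset_closure (Set.mem_range_self n)
  exact ⟨a, closure_minimal (Set.range_subset_iff.2 hf) isClosed_closure ha, s, hs, hsa⟩

end General

/-! ### Operators from a Hilbert space into a Schur space -/

section Hilbert

open scoped InnerProductSpace

variable {𝕜 : Type*} [RCLike 𝕜] {H : Type*} [NormedAddCommGroup H] [InnerProductSpace 𝕜 H]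
  {X : Type*} [NormedAddCommGroup X] [NormedSpace 𝕜 X]

/-- Bessel's inequality makes every orthonormal sequence weakly null. -/
theorem Orthonormal.tendsto_dual_zero [CompleteSpace H] {u : ℕ → H} (hu : Orthonormal 𝕜 u)
    (φ : H →L[𝕜] 𝕜) : Tendsto (fun n => φ (u n)) atTop (𝓝 0) := by
  have h := (hu.inner_products_summable
    ((InnerProductSpace.toDual 𝕜 H).symm φ)).tendsto_atTop_zero.sqrt
  simp only [Real.sqrt_sq (norm_nonneg _), Real.sqrt_zero] at h
  rw [tendsto_zero_iff_norm_tendsto_zero]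
  refine h.congr fun n => ?_
  rw [norm_inner_symm, InnerProductSpace.toDual_symm_apply]

/-- If there were no such `F`, unit vectors with `‖J u‖ > ε` could be chosen one after another, each orthogonal to
the previous ones, and `J` would map a weakly null sequence to one that is not norm null. -/
theorem exists_finiteDimensional_norm_apply_le [CompleteSpace H] (hX : IsSchurSpace 𝕜 X)
    (J : H →L[𝕜] X) {ε : ℝ} (hε : 0 < ε) :
    ∃ F : Submodule 𝕜 H, FiniteDimensional 𝕜 F ∧ ∀ u ∈ Fᗮ, ‖J u‖ ≤ ε * ‖u‖ := by
  by_contra! hcon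
  obtain ⟨u, hu, hu'⟩ := exists_seq_of_forall_finset_exists
    (fun u : H => ‖u‖ = 1 ∧ ε < ‖J u‖) (fun u v => ⟪u, v⟫_𝕜 = 0) (fun s _ => by
      obtain ⟨v, hv, hJv⟩ := hcon (Submodule.span 𝕜 (s : Set H))
        (FiniteDimensional.span_finset 𝕜 s)
      have hv0 : 0 < ‖v‖ := norm_pos_iff.2 fun h => by simp [h] at hJv
      refine ⟨((‖v‖⁻¹ : ℝ) : 𝕜) • v, ⟨?_, ?_⟩, fun x hx => ?_⟩
      · rw [norm_smul, RCLike.norm_ofReal, abs_of_nonneg (by positivity), inv_mul_cancel₀ hv0.ne']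
      · rw [map_smul, norm_smul, RCLike.norm_ofReal, abs_of_nonneg (by positivity),
          inv_mul_eq_div, lt_div_iff₀ hv0]
        exact hJv
      · rw [inner_smul_right, (Submodule.mem_orthogonal _ _).1 hv x (Submodule.subset_span hx),
          mul_zero])
  have hon : Orthonormal 𝕜 u := ⟨fun n => (hu n).1, fun i j hij => by
    rcases hij.lt_or_gt with h | h
    · exact hu' i j h
    · rw [inner_eq_zero_symm]
      exact hu' j i h⟩
  have hJ : Tendsto (fun n => J (u n)) atTop (𝓝 0) := hX _ _ <| tendsto_toWeakSpace_iff.2 fun φ => by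
    rw [map_zero]
    exact hon.tendsto_dual_zero (φ.comp J)
  have := le_of_tendsto_of_tendsto' tendsto_const_nhds hJ.norm fun n => (hu n).2.le
  rw [norm_zero] at this
  linarith

/-- Operators from a Hilbert space into a Schur space are compact: up to a small error they factor
through the projection onto a finite-dimensional subspace. -/
theorem totallyBounded_image_closedBall_of_isSchurSpace [CompleteSpace H] (hX : IsSchurSpace 𝕜 X)
    (J : H →L[𝕜] X) (R : ℝ) : TotallyBounded (J '' Metric.closedBall 0 R) := by
  refine totallyBounded_of_forall_approx fun ε hε => ?_
  have hR : 0 < |R| + 1 := by positivity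
  obtain ⟨F, hF, hJF⟩ := exists_finiteDimensional_norm_apply_le hX J (div_pos hε hR)
  have := FiniteDimensional.proper_rclike 𝕜 F
  refine ⟨(fun v : F => J v) '' Metric.closedBall 0 R,
    ((isCompact_closedBall _ _).image (by fun_prop)).totallyBounded, ?_⟩
  rintro _ ⟨u, hu, rfl⟩
  rw [mem_closedBall_zero_iff] at hu
  refine ⟨_, ⟨F.orthogonalProjectionOnto u, ?_, rfl⟩, ?_⟩
  · rw [mem_closedBall_zero_iff]
    exact (F.norm_orthogonalProjectionOnto_apply_le u).trans hu
  · have h1 := hJF _ (F.sub_starProjection_mem_orthogonal u)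
    have h2 : ‖u - F.starProjection u‖ ≤ |R| + 1 := by
      have h3 := F.norm_sq_eq_add_norm_sq_starProjection u
      rw [F.starProjection_orthogonal_val] at h3
      nlinarith [norm_nonneg u, norm_nonneg (u - F.starProjection u), le_abs_self R,
        sq_nonneg ‖F.starProjection u‖]
    rw [dist_eq_norm, ← map_sub]
    refine h1.trans ?_
    calc _ ≤ ε / (|R| + 1) * (|R| + 1) := by gcongr
      _ = ε := div_mul_cancel₀ _ hR.ne'

end Hilbert

/-! ### Order intervals in `L¹` -/

section OrderInterval

variable {𝕜 : Type*} [RCLike 𝕜] {Ω : Type*} [MeasurableSpace Ω] {μ : Measure Ω}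

/-- The order interval is the image of a bounded set under multiplication by `g`, as an operator
from the Hilbert space `L²` to `L¹`. -/
theorem totallyBounded_setOf_norm_le_mul_norm_sq (hX : IsSchurSpace 𝕜 (Lp 𝕜 1 μ))
    (g : Lp 𝕜 2 μ) (C : ℝ) :
    TotallyBounded {f : Lp 𝕜 1 μ | ∀ᵐ x ∂μ, ‖f x‖ ≤ C * ‖g x‖ ^ 2} := by
  let J : Lp 𝕜 2 μ →L[𝕜] Lp 𝕜 1 μ := (ContinuousLinearMap.mul 𝕜 𝕜).holderL μ 2 2 1 g
  refine (totallyBounded_image_closedBall_of_isSchurSpace hX J (C * ‖g‖)).subset fun f hf => ?_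
  have hfg : ∀ᵐ x ∂μ, ‖f x / g x‖ ≤ C * ‖g x‖ := by
    filter_upwards [hf] with x hx
    rw [norm_div]
    rcases (norm_nonneg (g x)).eq_or_lt with h | h
    · simp [← h]
    · rw [div_le_iff₀ h, mul_assoc, ← sq]
      exact hx
  have hu : MemLp (fun x => f x / g x) 2 μ := (Lp.memLp g).of_le_mul
    ((Lp.aestronglyMeasurable f).aemeasurable.div
      (Lp.aestronglyMeasurable g).aemeasurable).aestronglyMeasurable hfg
  -- `f / g` is the preimage of `f`; where `g = 0`, also `f = 0`, so that `0 / 0 = 0` does no harm.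
  refine ⟨hu.toLp _, ?_, ?_⟩
  · rw [mem_closedBall_zero_iff]
    refine Lp.norm_le_mul_norm_of_ae_le_mul ?_
    filter_upwards [hu.coeFn_toLp, hfg] with x h1 h2
    rwa [h1]
  · refine Lp.ext ?_
    filter_upwards [(ContinuousLinearMap.mul 𝕜 𝕜).coeFn_holder (r := 1) g (hu.toLp _),
      hu.coeFn_toLp, hf] with x h1 h2 h3
    refine h1.trans ?_
    rw [h2, ContinuousLinearMap.mul_apply']
    rcases eq_or_ne (g x) 0 with h | h
    · have : f x = 0 := by simpa [h] using h3
      simp [h, this]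
    · exact mul_div_cancel₀ _ h

end OrderInterval

/-! ### Operators from `L¹` to `ℓ¹` -/

section Operator

variable {𝕜 : Type*} [RCLike 𝕜] {Ω : Type*} [MeasurableSpace Ω] {μ : Measure Ω}

/-- Weights `h k` with `∑ k, ‖h k‖ ≤ 1` pointwise define an operator `f ↦ (∫ h k * f)_k` from `L¹`
to `ℓ¹`. -/
theorem exists_clm_lp_one_apply_eq_integral {h : ℕ → Ω → 𝕜}
    (hm : ∀ k, AEStronglyMeasurable (h k) μ) (hs : ∀ (s : Finset ℕ) x, ∑ k ∈ s, ‖h k x‖ ≤ 1) :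
    ∃ T : Lp 𝕜 1 μ →L[𝕜] lp (fun _ : ℕ => 𝕜) 1, ∀ f k, T f k = ∫ x, h k x * f x ∂μ := by
  have h1 : ∀ k x, ‖h k x‖ ≤ 1 := fun k x => by simpa using hs {k} x
  have hi : ∀ k (f : Lp 𝕜 1 μ), Integrable (fun x => h k x * f x) μ := fun k f =>
    (L1.integrable_coeFn f).bdd_mul (hm k) (ae_of_all _ (h1 k))
  have hb : ∀ (f : Lp 𝕜 1 μ) (s : Finset ℕ), ∑ k ∈ s, ‖∫ x, h k x * f x ∂μ‖ ≤ ‖f‖ := fun f s =>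
    calc ∑ k ∈ s, ‖∫ x, h k x * f x ∂μ‖ ≤ ∑ k ∈ s, ∫ x, ‖h k x * f x‖ ∂μ :=
          Finset.sum_le_sum fun k _ => norm_integral_le_integral_norm _
      _ = ∫ x, ∑ k ∈ s, ‖h k x * f x‖ ∂μ := (integral_finsetSum _ fun k _ => (hi k f).norm).symm
      _ ≤ ∫ x, ‖f x‖ ∂μ := by
          refine integral_mono (integrable_finsetSum _ fun k _ => (hi k f).norm)
            (L1.integrable_coeFn f).norm fun x => ?_
          simp only [norm_mul, ← Finset.sum_mul]
          exact mul_le_of_le_one_left (norm_nonneg _) (hs s x)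
      _ = ‖f‖ := (L1.norm_eq_integral_norm f).symm
  have hmem : ∀ f : Lp 𝕜 1 μ, Memℓp (fun k => ∫ x, h k x * f x ∂μ) 1 := fun f =>
    memℓp_gen' (C := ‖f‖) fun s => by simpa using hb f s
  refine ⟨LinearMap.mkContinuous
    { toFun := fun f => (⟨_, hmem f⟩ : lp (fun _ : ℕ => 𝕜) 1)
      map_add' := fun f g => lp.ext <| funext fun k => ?_
      map_smul' := fun c f => lp.ext <| funext fun k => ?_ } 1 fun f => ?_, fun f k => rfl⟩
  · refine (integral_congr_ae ?_).trans (integral_add (hi k f) (hi k g))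
    filter_upwards [Lp.coeFn_add f g] with x hx
    rw [hx, Pi.add_apply, mul_add]
  · refine (integral_congr_ae ?_).trans (integral_const_mul c _)
    filter_upwards [Lp.coeFn_smul c f] with x hx
    rw [hx, Pi.smul_apply, smul_eq_mul, mul_left_comm]
  · rw [one_mul]
    exact lp.norm_le_of_forall_sum_le (by simp) (norm_nonneg _) fun s => by simpa using hb f s

end Operator

/-! ### Uniform integrability of coarse `1`-limited sequences -/

section UniformIntegrability

variable {𝕜 : Type*} [RCLike 𝕜] {Ω : Type*} [MeasurableSpace Ω] {μ : Measure Ω}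

theorem setIntegral_iUnion_le_of_hasSum {f : Ω → ℝ} (hf : Integrable f μ) (h0 : ∀ x, 0 ≤ f x)
    (E : ℕ → Set Ω) {b : ℕ → ℝ} {B : ℝ} (hb : HasSum b B) (hE : ∀ i, ∫ x in E i, f x ∂μ ≤ b i) :
    ∫ x in ⋃ i, E i, f x ∂μ ≤ B := by
  have hb0 : ∀ i, 0 ≤ b i := fun i => (integral_nonneg h0).trans (hE i)
  have hofReal : ∀ s : Set Ω,
      ENNReal.ofReal (∫ x in s, f x ∂μ) = ∫⁻ x in s, ENNReal.ofReal (f x) ∂μ := fun s =>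
    ofReal_integral_eq_lintegral_ofReal hf.integrableOn (ae_of_all _ h0)
  rw [← ENNReal.ofReal_le_ofReal_iff (hb.nonneg hb0), hofReal, ← hb.tsum_eq,
    ENNReal.ofReal_tsum_of_nonneg hb0 hb.summable]
  refine (lintegral_iUnion_le _ _).trans (ENNReal.tsum_le_tsum fun i => ?_)
  rw [← hofReal]
  exact ENNReal.ofReal_le_ofReal (hE i)

/-- A coarse `1`-limited sequence in `L¹` cannot keep mass `ε` on pairwise disjoint sets: pairing
with the signs of `g k` on `S k` would give an operator to `ℓ¹` with all diagonal entries at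
least `ε`. -/
theorem IsCoarseLimited.exists_setIntegral_lt {g : ℕ → Lp 𝕜 1 μ} {A : Set (Lp 𝕜 1 μ)}
    (hA : IsCoarseLimited 𝕜 1 A) (hg : ∀ k, g k ∈ A) {S : ℕ → Set Ω}
    (hS : ∀ k, MeasurableSet (S k)) (hd : Pairwise (Function.onFun Disjoint S)) {ε : ℝ}
    (hε : 0 < ε) : ∃ k, ∫ x in S k, ‖g k x‖ ∂μ < ε := by
  let h : ℕ → Ω → 𝕜 := fun k =>
    (S k).indicator fun x => (starRingEnd 𝕜) (g k x) / (‖g k x‖ : 𝕜)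
  have hm : ∀ k, AEStronglyMeasurable (h k) μ := fun k => by
    have hgk := (Lp.aestronglyMeasurable (g k)).aemeasurable
    refine AEStronglyMeasurable.indicator (AEMeasurable.aestronglyMeasurable ?_) (hS k)
    exact (RCLike.continuous_conj.measurable.comp_aemeasurable hgk).div
      (RCLike.continuous_ofReal.measurable.comp_aemeasurable hgk.norm)
  have hs : ∀ (s : Finset ℕ) x, ∑ k ∈ s, ‖h k x‖ ≤ 1 := fun s x =>
    calc ∑ k ∈ s, ‖h k x‖ ≤ ∑ k ∈ s, (S k).indicator (fun _ => (1 : ℝ)) x :=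
          Finset.sum_le_sum fun k _ => by
            rw [norm_indicator_eq_indicator_norm]
            exact Set.indicator_le_indicator (norm_conj_div_norm_le _)
      _ = (⋃ k ∈ s, S k).indicator (fun _ => (1 : ℝ)) x :=
          (Finset.indicator_biUnion_apply s S (fun i _ j _ hij => hd hij) x).symm
      _ ≤ 1 := Set.indicator_le_self' (fun _ _ => zero_le_one) x
  obtain ⟨T, hT⟩ := exists_clm_lp_one_apply_eq_integral hm hs
  obtain ⟨k, hk⟩ := exists_norm_diagonal_lt (x := fun k => T (g k)) (hA T)
    (fun k => subset_closure (Set.mem_image_of_mem T (hg k))) hε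
  refine ⟨k, ?_⟩
  have hTk : T (g k) k = ((∫ x in S k, ‖g k x‖ ∂μ : ℝ) : 𝕜) := by
    rw [hT, ← integral_indicator (hS k), ← integral_ofReal]
    refine integral_congr_ae (ae_of_all _ fun x => ?_)
    by_cases hx : x ∈ S k
    · simp only [h, Set.indicator_of_mem hx, conj_div_norm_mul_self]
    · simp [h, Set.indicator_of_notMem hx]
  rw [hTk, RCLike.norm_ofReal] at hk
  exact (le_abs_self _).trans_lt hk

/-- The sets `{C * φ < |f n|}` carry little of the mass of any `g` dominated by a multiple of `φ`,
when `C` is large. -/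
theorem setIntegral_norm_le_of_ae_le_mul {f g : Lp 𝕜 1 μ} {φ : Ω → ℝ} (hφ : StronglyMeasurable φ)
    {a C M : ℝ} (ha : 0 ≤ a) (hC : 0 < C) (hf : ‖f‖ ≤ M) (hg : ∀ᵐ x ∂μ, ‖g x‖ ≤ a * φ x) :
    ∫ x in {x | C * φ x < ‖f x‖}, ‖g x‖ ∂μ ≤ a * M / C := by
  have hE : MeasurableSet {x | C * φ x < ‖f x‖} :=
    (hφ.const_mul C).measurableSet_lt (Lp.stronglyMeasurable f).norm
  have hfi := (L1.integrable_coeFn f).norm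
  calc ∫ x in {x | C * φ x < ‖f x‖}, ‖g x‖ ∂μ
      ≤ ∫ x in {x | C * φ x < ‖f x‖}, a / C * ‖f x‖ ∂μ := by
        refine setIntegral_mono_on_ae (L1.integrable_coeFn g).norm.integrableOn
          (hfi.const_mul _).integrableOn hE ?_
        filter_upwards [hg] with x hx hxE
        calc ‖g x‖ ≤ a * φ x := hx
          _ = a / C * (C * φ x) := by field_simp
          _ ≤ a / C * ‖f x‖ := mul_le_mul_of_nonneg_left hxE.le (by positivity)
    _ = a / C * ∫ x in {x | C * φ x < ‖f x‖}, ‖f x‖ ∂μ := integral_const_mul _ _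
    _ ≤ a / C * M := by
        refine mul_le_mul_of_nonneg_left ?_ (by positivity)
        refine (setIntegral_le_integral hfi (ae_of_all _ fun x => norm_nonneg _)).trans ?_
        rwa [← L1.norm_eq_integral_norm]
    _ = a * M / C := by ring

/-- If this failed, heights `C k` growing fast enough would give members `g k` of the sequence with
mass `ε` on `E k = {C k * φ < |g k|}`, while the later sets `E j`, `j > k`, take away at most `ε / 2`
of it. This leaves mass `ε / 2` on pairwise disjoint sets. -/
theorem IsCoarseLimited.exists_forall_setIntegral_le {f : ℕ → Lp 𝕜 1 μ} {A : Set (Lp 𝕜 1 μ)}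
    (hA : IsCoarseLimited 𝕜 1 A) (hf : ∀ n, f n ∈ A) {φ : Ω → ℝ} (hφ : StronglyMeasurable φ)
    {a : ℕ → ℝ} (ha : ∀ n, 0 ≤ a n)
    (hfφ : ∀ n, ∀ᵐ x ∂μ, ‖f n x‖ ≤ a n * φ x) {ε : ℝ} (hε : 0 < ε) :
    ∃ C > 0, ∀ n, ∫ x in {x | C * φ x < ‖f n x‖}, ‖f n x‖ ∂μ ≤ ε := by
  by_contra! hcon
  obtain ⟨M, hM, hAM⟩ := hA.exists_norm_le
  choose! n hn using hcon
  -- Doubling makes `∑ j > k, 1 / C j` at most `2 / C (k + 1)`, and the second summand makes this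
  -- times `a (n (C k)) * M` at most `ε / 2`.
  let C : ℕ → ℝ := Nat.rec 1 fun _ c => 2 * c + 4 * M / ε * a (n c)
  have hCs : ∀ k, C (k + 1) = 2 * C k + 4 * M / ε * a (n (C k)) := fun k => rfl
  have hC : ∀ k, 0 < C k := fun k => by
    induction k with
    | zero => exact one_pos
    | succ k ih =>
      rw [hCs]
      have := ha (n (C k))
      positivity
  have hCgrow : ∀ k i, 2 ^ i * (4 * M / ε * a (n (C k))) ≤ C (k + 1 + i) := fun k i => by
    induction i with
    | zero =>
      rw [add_zero, hCs]
      linarith [hC k]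
    | succ i ih =>
      rw [← add_assoc, hCs, pow_succ]
      have : 0 ≤ 4 * M / ε * a (n (C (k + 1 + i))) := mul_nonneg (by positivity) (ha _)
      linarith
  let g : ℕ → Lp 𝕜 1 μ := fun k => f (n (C k))
  let E : ℕ → Set Ω := fun k => {x | C k * φ x < ‖g k x‖}
  have hE : ∀ k, MeasurableSet (E k) := fun k =>
    (hφ.const_mul _).measurableSet_lt (Lp.stronglyMeasurable _).norm
  let U : ℕ → Set Ω := fun k => ⋃ i, E (k + 1 + i)
  have hU : ∀ k, MeasurableSet (U k) := fun k => MeasurableSet.iUnion fun i => hE _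
  have hgi : ∀ k, Integrable (fun x => ‖g k x‖) μ := fun k => (L1.integrable_coeFn _).norm
  have hUle : ∀ k, ∫ x in U k, ‖g k x‖ ∂μ ≤ ε / 2 := fun k => by
    have hsum : HasSum (fun i : ℕ => ε / 4 * (1 / 2) ^ i) (ε / 2) := by
      have := hasSum_geometric_two.mul_left (ε / 4)
      rwa [show ε / 4 * 2 = ε / 2 by ring] at this
    refine setIntegral_iUnion_le_of_hasSum (hgi k) (fun x => norm_nonneg _) _ hsum fun i => ?_
    refine (setIntegral_norm_le_of_ae_le_mul hφ (ha _) (hC _) (hAM _ (hf _))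
      (hfφ _)).trans ?_
    rw [div_le_iff₀ (hC _)]
    refine le_trans (le_of_eq ?_) (mul_le_mul_of_nonneg_left (hCgrow k i)
      (by positivity : 0 ≤ ε / 4 * (1 / 2) ^ i))
    have h2 : ((1 : ℝ) / 2) ^ i * 2 ^ i = 1 := by rw [← mul_pow]; norm_num
    calc a (n (C k)) * M = a (n (C k)) * M * ((1 / 2) ^ i * 2 ^ i) := by rw [h2, mul_one]
      _ = _ := by field_simp
  obtain ⟨k, hk⟩ := hA.exists_setIntegral_lt (g := g) (fun k => hf _) (S := fun k => E k \ U k)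
    (fun k => (hE k).diff (hU k)) (by
      refine (Std.Symm.pairwise_on (r := Disjoint) _).2 fun k j hkj => ?_
      refine Set.disjoint_left.2 fun x hxk hxj => hxk.2 (Set.mem_iUnion.2 ⟨j - (k + 1), ?_⟩)
      rw [Nat.add_sub_of_le hkj]
      exact hxj.1) (half_pos hε)
  have h1 : ε < ∫ x in E k, ‖g k x‖ ∂μ := hn (C k) (hC k)
  have h2 := integral_inter_add_sdiff (s := E k) (hU k) (hgi k).integrableOn
  have h3 : ∫ x in E k ∩ U k, ‖g k x‖ ∂μ ≤ ∫ x in U k, ‖g k x‖ ∂μ :=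
    setIntegral_mono_set (hgi k).integrableOn (ae_of_all _ fun x => norm_nonneg _)
      Set.inter_subset_right.eventuallyLE
  linarith [hUle k]

/-- A bounded sequence in `L¹` is dominated, term by term up to constants, by the single integrable
function `∑ n, 2⁻ⁿ |f n|`. -/
theorem exists_dominating_of_norm_le {f : ℕ → Lp 𝕜 1 μ} {M : ℝ} (hf : ∀ n, ‖f n‖ ≤ M) :
    ∃ φ : Lp ℝ 1 μ, 0 ≤ φ ∧ ∀ n, ∀ᵐ x ∂μ, ‖f n x‖ ≤ 2 ^ n * φ x := by
  let F : ℕ → Lp ℝ 1 μ := fun n => (Lp.memLp (f n)).norm.toLp _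
  have hF : ∀ n, F n =ᵐ[μ] fun x => ‖f n x‖ := fun n => MemLp.coeFn_toLp _
  have hF0 : ∀ n, 0 ≤ ((1 : ℝ) / 2) ^ n • F n := fun n => by
    rw [← Lp.coeFn_nonneg]
    filter_upwards [Lp.coeFn_smul (((1 : ℝ) / 2) ^ n) (F n), hF n] with x h1 h2
    rw [h1, Pi.smul_apply, h2, smul_eq_mul, Pi.zero_apply]
    positivity
  have hs : Summable fun n => ((1 : ℝ) / 2) ^ n • F n := by
    refine Summable.of_norm_bounded (summable_geometric_two.mul_right M) fun n => ?_
    rw [norm_smul, norm_pow, Real.norm_of_nonneg (by positivity : (0 : ℝ) ≤ 1 / 2)]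
    refine mul_le_mul_of_nonneg_left ?_ (by positivity)
    rw [Lp.norm_toLp, eLpNorm_norm, ← Lp.norm_def]
    exact hf n
  refine ⟨∑' n, ((1 : ℝ) / 2) ^ n • F n, tsum_nonneg hF0, fun n => ?_⟩
  have hle := hs.le_tsum n fun j _ => hF0 j
  rw [← Lp.coeFn_le] at hle
  filter_upwards [hle, Lp.coeFn_smul (((1 : ℝ) / 2) ^ n) (F n), hF n] with x h1 h2 h3
  rw [h2, Pi.smul_apply, h3, smul_eq_mul, one_div_pow, one_div_mul_eq_div,
    div_le_iff₀' (by positivity)] at h1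
  exact h1

/-- The truncations of `f n` at height `C * φ` lie in an order interval, and by uniform
integrability they approximate `f n` uniformly in `n`. -/
theorem IsCoarseLimited.totallyBounded_range (hX : IsSchurSpace 𝕜 (Lp 𝕜 1 μ)) {f : ℕ → Lp 𝕜 1 μ}
    {A : Set (Lp 𝕜 1 μ)} (hA : IsCoarseLimited 𝕜 1 A) (hf : ∀ n, f n ∈ A) :
    TotallyBounded (Set.range f) := by
  obtain ⟨M, -, hM⟩ := hA.exists_norm_le
  obtain ⟨φ, hφ0, hφ⟩ := exists_dominating_of_norm_le fun n => hM _ (hf n)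
  have hφi := L1.integrable_coeFn φ
  rw [← Lp.coeFn_nonneg] at hφ0
  have hsqrt : MemLp (fun x => ((√(φ x) : ℝ) : 𝕜)) 2 μ := by
    refine MemLp.ofReal ((memLp_two_iff_integrable_sq
      (Real.continuous_sqrt.comp_aestronglyMeasurable hφi.1)).2 (hφi.congr ?_))
    filter_upwards [hφ0] with x hx
    exact (Real.sq_sqrt hx).symm
  refine totallyBounded_of_forall_approx fun ε hε => ?_
  obtain ⟨C, hC, hCε⟩ := hA.exists_forall_setIntegral_le hf (Lp.stronglyMeasurable φ)
    (fun n => by positivity) hφ hε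
  refine ⟨_, totallyBounded_setOf_norm_le_mul_norm_sq hX (hsqrt.toLp _) C, ?_⟩
  rintro _ ⟨n, rfl⟩
  let E : Set Ω := {x | C * φ x < ‖f n x‖}
  have hE : MeasurableSet E :=
    ((Lp.stronglyMeasurable φ).const_mul C).measurableSet_lt (Lp.stronglyMeasurable _).norm
  have ht : MemLp (Eᶜ.indicator (f n)) 1 μ := (Lp.memLp (f n)).indicator hE.compl
  refine ⟨ht.toLp _, ?_, ?_⟩
  · filter_upwards [ht.coeFn_toLp, hsqrt.coeFn_toLp, hφ0] with x h1 h2 h3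
    rw [h1, h2, RCLike.norm_ofReal, sq_abs, Real.sq_sqrt h3]
    by_cases hx : x ∈ E
    · simpa [hx] using mul_nonneg hC.le h3
    · rw [Set.indicator_of_mem (Set.mem_compl hx)]
      exact not_lt.1 hx
  · rw [dist_eq_norm, L1.norm_eq_integral_norm]
    refine le_trans (le_of_eq ?_) (hCε n)
    rw [← integral_indicator hE]
    refine integral_congr_ae ?_
    filter_upwards [Lp.coeFn_sub (f n) (ht.toLp _), ht.coeFn_toLp] with x h1 h2
    rw [h1, Pi.sub_apply, h2]
    by_cases hx : x ∈ E <;> simp [hx, E]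

end UniformIntegrability

/-! ### The coarse Gelfand-Phillips property of `L¹` -/

theorem mainTheorem9 {𝕜 : Type*} [RCLike 𝕜] {Ω : Type*} [MeasurableSpace Ω] (μ : Measure Ω) :
    CoarseGelfandPhillips 𝕜 1 (Lp 𝕜 1 μ) ↔ IsSchurSpace 𝕜 (Lp 𝕜 1 μ) :=
  ⟨fun h => h.isSchurSpace, fun hX _ hA =>
    isCompact_closure_of_forall_seq fun _ hf => hA.closure.totallyBounded_range hX hf⟩
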